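/- Conventions. A simplicial complex on $[m]=\{1,\dots,m\}$ is a family of subsets of $[m]$ that is closed under taking subsets and contains $\emptyset$. For simplicial complexes $K\subseteq L$ on $[m]$ and $1\le s\le r$, the $(K,L)$-collection of type $(r,s)$ is the sequence $\langle K_1,\dots,K_r\rangle$ with $K_i=L$ for $i\le s$ and $K_i=K$ for $i>s$. Its symmetrized deleted join $SDJ_s^r(K,L)$ is the simplicial complex on the vertex set $[m]\times[r]$ whose simplices are the sets $\bigcup_{i=1}^r A_i\times\{i\}$, where $A_1,\dots,A_r\subseteq[m]$ are pairwise disjoint and, for some permutation $\pi$ of $[r]$, $A_i\in K_{\pi(i)}$ for all $i$. The cyclic group $\mathbb{Z}_r$ acts on it by cyclically shifting $[r]$. For a finite group $G$ and a $G$-space $X$, the index ${\rm Ind}_G(X)$ is the least integer $n\ge 0$ for which there is a continuous $G$-equivariant map $X\to E_nG$, and $\infty$ if there is none; here $E_nG=G^{*(n+1)}$ is the geometric realization of the join of $n+1$ copies of the discrete set $G$, with $G$ acting by left multiplication. The index of a simplicial complex is that of its geometric realization. Proposition. Let $r\ge 3$ be a prime number, let $1\le s<t<r$, and let $G=\mathbb{Z}_r$.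 Let $K\subseteq L$ be simplicial complexes on $[m]$. Then $$ {\rm Ind}_{G}\bigl(SDJ_s^r(K,L)\bigr)\;\ge\;{\rm Ind}_{G}\bigl(SDJ_t^r(K,L)\bigr)+s-t . $$ -/

import Mathlib

/-! ### Geometric realization and group actions -/

/-- The geometric realization of a simplicial complex `K` with finite vertex set `V`, as a subspace
of `V → ℝ`: the union, over the faces `σ` of `K`, of the geometric simplices spanned by the
standard basis vectors `e_v`, `v ∈ σ`. (In Mathlib's convention the empty face is not listed among
the faces of a complex.) -/
def realization {V : Type*} [Fintype V] (K : PreAbstractSimplicialComplex V) : Set (V → ℝ) :=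
  {x | x ∈ stdSimplex ℝ V ∧ ∃ σ ∈ K.faces, ∀ v, x v ≠ 0 → v ∈ σ}

/-- A simplicial complex is `G`-invariant if the action of `G` on the vertices maps faces to
faces. -/
class InvariantComplex (G : Type*) [Group G] {V : Type*} [MulAction G V]
    (K : PreAbstractSimplicialComplex V) : Prop where
  map_mem : ∀ (g : G), ∀ σ ∈ K.faces, σ.map (MulAction.toPerm g).toEmbedding ∈ K.faces

/-- The action of `G` on the realization of an invariant complex: the simplicial action, which
sends the vertex `e_v` to `e_{g • v}` and is affine on each simplex. -/
instance realizationAction {G : Type*} [Group G] {V : Type*} [Fintype V] [MulAction G V]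
    (K : PreAbstractSimplicialComplex V) [InvariantComplex G K] :
    MulAction G (realization K) where
  smul g x := ⟨fun v => x.1 (g⁻¹ • v), by
    obtain ⟨⟨h0, h1⟩, σ, hσ, hx⟩ := x.2
    refine ⟨⟨fun v => h0 _, ?_⟩, _, InvariantComplex.map_mem g σ hσ, fun v hv => ?_⟩
    · rw [← h1]
      exact Equiv.sum_comp (MulAction.toPerm g⁻¹) x.1
    · exact Finset.mem_map.2 ⟨g⁻¹ • v, hx _ hv, smul_inv_smul g v⟩⟩
  one_smul x := Subtype.ext (funext fun v =>
    congrArg x.1 (show (1 : G)⁻¹ • v = v by rw [inv_one, one_smul]))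
  mul_smul g h x := Subtype.ext (funext fun v =>
    congrArg x.1 (show (g * h)⁻¹ • v = h⁻¹ • g⁻¹ • v by rw [mul_inv_rev, mul_smul]))

/-! ### Joins and the index -/

/-- Pairs `⟨p, i⟩` of a point `p ∈ ι` and a row `i ∈ R`. A group acting on `R` acts on these pairs
by `g • ⟨p, i⟩ = ⟨p, g • i⟩`. -/
abbrev JoinVertex (ι R : Type*) : Type _ := Σ _ : ι, R

/-- The `(n + 1)`-fold join `G * G * ⋯ * G` of the discrete set `G`: a face has at most one vertex
in each of the `n + 1` copies of `G`. For a finite group `G`, with `G` acting by left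
multiplication on each copy, its realization is the standard model of the space `E_n G`: it is a
free, `n`-dimensional, `(n - 1)`-connected finite simplicial `G`-complex. -/
def iteratedJoin (G : Type*) (n : ℕ) : PreAbstractSimplicialComplex (JoinVertex (Fin (n + 1)) G) where
  faces := {σ | σ.Nonempty ∧ ∀ x ∈ σ, ∀ y ∈ σ, x.1 = y.1 → x = y}
  isRelLowerSet_faces := fun _ hσ =>
    ⟨hσ.1, fun _ hτ hne => ⟨hne, fun x hx y hy => hσ.2 x (hτ hx) y (hτ hy)⟩⟩

instance iteratedJoin_invariant (G : Type*) [Group G] (n : ℕ) :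
    InvariantComplex G (iteratedJoin G n) where
  map_mem g σ hσ := by
    refine ⟨hσ.1.map, fun x hx y hy hxy => ?_⟩
    obtain ⟨x', hx', rfl⟩ := Finset.mem_map.1 hx
    obtain ⟨y', hy', rfl⟩ := Finset.mem_map.1 hy
    exact congrArg _ (hσ.2 x' hx' y' hy' hxy)

/-- The index `Ind_G(X)` of a `G`-space `X`, for a finite group `G`: the least `n` such that there
is a continuous `G`-equivariant map `X → E_n G`, and `⊤` if there is none. -/
noncomputable def gIndex (G : Type*) [Group G] [Fintype G]
    (X : Type*) [TopologicalSpace X] [MulAction G X] : ℕ∞ :=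
  ⨅ n ∈ {n : ℕ | ∃ f : X → realization (iteratedJoin G n),
    Continuous f ∧ ∀ (g : G) (x : X), f (g • x) = g • f x}, (n : ℕ∞)

/-! ### Symmetrized deleted joins -/

/-- The part `A_i` of a set `σ` of pairs that lies in row `i`. -/
def rowPart {ι R : Type*} [Fintype ι] [DecidableEq ι] [DecidableEq R]
    (σ : Finset (JoinVertex ι R)) (i : R) : Finset ι :=
  {p | (⟨p, i⟩ : JoinVertex ι R) ∈ σ}

/-- The deleted join of a family `(K_i)` of complexes on the vertex set `ι`: the faces are the
families `(A_i)` of pairwise disjoint sets, not all empty, where each `A_i` is a face of `K_i` or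
empty. -/
def deletedJoin {ι R : Type*} [Fintype ι] [DecidableEq ι] [DecidableEq R]
    (K : R → PreAbstractSimplicialComplex ι) :
    PreAbstractSimplicialComplex (JoinVertex ι R) where
  faces := {σ | σ.Nonempty ∧ (∀ i j, i ≠ j → Disjoint (rowPart σ i) (rowPart σ j)) ∧
    ∀ i, rowPart σ i = ∅ ∨ rowPart σ i ∈ (K i).faces}
  isRelLowerSet_faces := fun σ hσ => by
    refine ⟨hσ.1, fun τ hτ hne => ?_⟩
    have hsub : ∀ i, rowPart τ i ⊆ rowPart σ i := fun i =>
      Finset.monotone_filter_right _ (fun _ _ h => hτ h)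
    refine ⟨hne, fun i j hij => (hσ.2.1 i j hij).mono (hsub i) (hsub j), fun i => ?_⟩
    rcases Finset.eq_empty_or_nonempty (rowPart τ i) with h | h
    · exact Or.inl h
    · rcases hσ.2.2 i with h' | h'
      · exact Or.inl (Finset.subset_empty.1 (h' ▸ hsub i))
      · exact Or.inr (((K i).isRelLowerSet_faces h').2 (hsub i) h)

/-- The symmetrized deleted join: the union of the deleted joins of all reorderings of the
family. -/
def symmetrizedDeletedJoin {ι R : Type*} [Fintype ι] [DecidableEq ι] [DecidableEq R]
    (K : R → PreAbstractSimplicialComplex ι) : PreAbstractSimplicialComplex (JoinVertex ι R) :=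
  ⨆ π : Equiv.Perm R, deletedJoin fun i => K (π i)

theorem mem_symmetrizedDeletedJoin {ι R : Type*} [Fintype ι] [DecidableEq ι] [DecidableEq R]
    (K : R → PreAbstractSimplicialComplex ι) (σ : Finset (JoinVertex ι R)) :
    σ ∈ (symmetrizedDeletedJoin K).faces ↔
      ∃ π : Equiv.Perm R, σ ∈ (deletedJoin fun i => K (π i)).faces := by
  change σ ∈ ⋃ L ∈ Set.range (fun π : Equiv.Perm R => deletedJoin fun i => K (π i)), L.faces ↔ _
  simp

theorem rowPart_map {ι R G : Type*} [Fintype ι] [DecidableEq ι] [DecidableEq R] [Group G]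
    [MulAction G R] (g : G) (σ : Finset (JoinVertex ι R)) (i : R) :
    rowPart (σ.map (MulAction.toPerm g).toEmbedding) i = rowPart σ (g⁻¹ • i) := by
  ext p
  simp only [rowPart, Finset.mem_filter, Finset.mem_univ, true_and, Finset.mem_map]
  constructor
  · rintro ⟨⟨q, j⟩, hq, h⟩
    obtain ⟨rfl, rfl⟩ : q = p ∧ g • j = i := by
      simpa [Sigma.smul_mk] using h
    simpa using hq
  · intro h
    exact ⟨_, h, by simp [Sigma.smul_mk]⟩

instance symmetrizedDeletedJoin_invariant {ι R G : Type*} [Fintype ι] [DecidableEq ι]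
    [DecidableEq R] [Group G] [MulAction G R] (K : R → PreAbstractSimplicialComplex ι) :
    InvariantComplex G (symmetrizedDeletedJoin K) where
  map_mem g σ hσ := by
    rw [mem_symmetrizedDeletedJoin] at hσ ⊢
    obtain ⟨π, hne, hd, hK⟩ := hσ
    refine ⟨(MulAction.toPerm g⁻¹).trans π, hne.map, fun i j hij => ?_, fun i => ?_⟩
    · rw [rowPart_map, rowPart_map]
      exact hd _ _ fun h => hij (smul_left_cancel _ h)
    · rw [rowPart_map]
      exact hK (g⁻¹ • i)

/-- The `(K, L)`-collection `⟨L, …, L, K, …, K⟩` of type `(r, s)`: `s` copies of `L` followed by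
`r - s` copies of `K`. The rows `1, …, r` are labelled by the residues `0, …, r - 1` modulo `r`, so
that the cyclic group `ℤ_r` permutes them by translation. -/
def klCollection {ι : Type*} (r s : ℕ) (K L : PreAbstractSimplicialComplex ι) :
    ZMod r → PreAbstractSimplicialComplex ι :=
  fun i => if i.val < s then L else K

/-- The symmetrized deleted join `SDJ_s^r(K, L)` of the `(K, L)`-collection of type `(r, s)`. -/
def SDJ {ι : Type*} [Fintype ι] [DecidableEq ι] (r s : ℕ)
    (K L : PreAbstractSimplicialComplex ι) :
    PreAbstractSimplicialComplex (JoinVertex ι (ZMod r)) :=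
  symmetrizedDeletedJoin (klCollection r s K L)

instance SDJ_invariant {ι : Type*} [Fintype ι] [DecidableEq ι] (r s : ℕ)
    (K L : PreAbstractSimplicialComplex ι) :
    InvariantComplex (Multiplicative (ZMod r)) (SDJ r s K L) :=
  symmetrizedDeletedJoin_invariant _

/-!
The `s`-th and `t`-th symmetrized deleted joins differ only in how many rows of a face may fail to
be faces of `K`: at most `s`, respectively at most `t`. For each row `i` the polynomial
`rowExcess K x i` in the barycentric coordinates of a point `x` is positive exactly when row `i` of
the support of `x` is neither empty nor a face of `K`. So the rows of positive excess of a point of the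
`t`-th join form a set `S ⊆ ℤ_r` with at most `t` elements, and the point lies in the `s`-th join
as soon as `S` has at most `s` elements (`mem_realization_SDJ_of_card_le`).

Given an equivariant map `f` from the `s`-th join to `E_n G`, an equivariant map from the `t`-th
join to `E_{n + t - s} G` is assembled from unnormalized join coordinates
(`gIndex_le_of_weights`), of two kinds.

* The coordinates of `f`, extended to the ambient vector space by Tietze's theorem. The extension
  no longer has at most one nonzero coordinate in each copy of `G`; replacing the coordinates `y` by
  the dominance weights `∏ h ≠ g, max 0 (y g - y h)` restores this and does not make them vanish on
  the `s`-th join.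
* For each size `c` with `s < c ≤ t`, one further copy of `G`: a set `S ⊆ ℤ_r` with `c` elements
  whose excesses dominate all the others contributes its dominance weight at the barycenter of `S`
  in `ℤ_r`. This barycenter exists and is equivariant because `0 < c < r` and `r` is prime. There
  is at most one such `S` for each `c`.

If the number `c` of rows of positive excess is greater than `s`, then these rows form a dominating
set of size `c` and the second kind of coordinates does not vanish; otherwise the point lies in the
`s`-th join and the first kind does not vanish.
-/

/-! ### Equivariant maps to iterated joins -/

/-- A family of continuous nonnegative join coordinates, nowhere all zero and with at most one
nonzero coordinate in each of `N + 1` copies of `G`, bounds the index by `N`: normalize the sum of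
the coordinates to `1`. -/
theorem gIndex_le_of_weights {G : Type*} [Group G] [Fintype G] {X : Type*} [TopologicalSpace X]
    [MulAction G X] {ι : Type*} [Fintype ι] {N : ℕ} (hι : Fintype.card ι = N + 1)
    (z : X → ι → G → ℝ) (hc : ∀ k g, Continuous fun x => z x k g) (h0 : ∀ x k g, 0 ≤ z x k g)
    (heq : ∀ (a : G) x k g, z (a • x) k g = z x k (a⁻¹ * g))
    (huniq : ∀ x k g g', z x k g ≠ 0 → z x k g' ≠ 0 → g = g')
    (hne : ∀ x, ∃ k g, z x k g ≠ 0) : gIndex G X ≤ N := by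
  classical
  let e : Fin (N + 1) ≃ ι := (Fintype.equivFinOfCardEq hι).symm
  let T : X → ℝ := fun x => ∑ v : JoinVertex (Fin (N + 1)) G, z x (e v.1) v.2
  have hT : ∀ x, 0 < T x := fun x => by
    obtain ⟨k, g, h⟩ := hne x
    refine Finset.sum_pos' (fun v _ => h0 x _ _) ⟨⟨e.symm k, g⟩, Finset.mem_univ _, ?_⟩
    simpa using lt_of_le_of_ne (h0 x k g) h.symm
  have hTc : Continuous T := continuous_finsetSum _ fun v _ => hc _ _
  have hTinv : ∀ (a : G) x, T (a • x) = T x := fun a x => by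
    refine Fintype.sum_equiv (MulAction.toPerm a⁻¹) _ _ fun v => ?_
    exact heq a x (e v.1) v.2
  refine iInf₂_le N ⟨fun x => ⟨fun v => z x (e v.1) v.2 / T x, ⟨fun v => div_nonneg (h0 _ _ _)
    (hT x).le, ?_⟩, Finset.univ.filter fun v => z x (e v.1) v.2 ≠ 0, ⟨?_, ?_⟩, ?_⟩, ?_, ?_⟩
  · rw [← Finset.sum_div]
    exact div_self (hT x).ne'
  · obtain ⟨k, g, h⟩ := hne x
    exact ⟨⟨e.symm k, g⟩, by simpa using h⟩
  · rintro ⟨k, g⟩ hv ⟨k', g'⟩ hw rfl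
    rw [huniq x (e k) g g' (by simpa using hv) (by simpa using hw)]
  · intro v hv
    simp only [Finset.mem_filter, Finset.mem_univ, true_and]
    exact fun h => hv (div_eq_zero_iff.2 (Or.inl h))
  · exact Continuous.subtype_mk (continuous_pi fun v => (hc _ _).div hTc fun x => (hT x).ne') _
  · intro a x
    refine Subtype.ext (funext fun v => ?_)
    change z (a • x) (e v.1) v.2 / T (a • x) = z x (e v.1) (a⁻¹ * v.2) / T x
    rw [heq, hTinv]

/-! ### Dominating sets of coordinates -/

/-- The dominance weight of a set `S` of coordinates of a vector `u`: nonnegative, and positive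
exactly when every coordinate in `S` exceeds every coordinate outside `S`. -/
def dominance {R : Type*} [Fintype R] [DecidableEq R] (u : R → ℝ) (S : Finset R) : ℝ :=
  ∏ i ∈ S, ∏ j ∈ Sᶜ, max 0 (u i - u j)

section dominance

variable {R : Type*} [Fintype R] [DecidableEq R]

theorem dominance_nonneg (u : R → ℝ) (S : Finset R) : 0 ≤ dominance u S :=
  Finset.prod_nonneg fun _ _ => Finset.prod_nonneg fun _ _ => le_max_left _ _

theorem dominance_ne_zero_iff (u : R → ℝ) (S : Finset R) :
    dominance u S ≠ 0 ↔ ∀ i ∈ S, ∀ j ∉ S, u j < u i := by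
  simp only [dominance, Finset.prod_ne_zero_iff, Finset.mem_compl]
  refine forall₄_congr fun i _ j _ => ?_
  rw [← sub_pos, ne_comm, ← (le_max_left _ _).lt_iff_ne, lt_max_iff]
  simp

theorem eq_of_dominance_ne_zero {u : R → ℝ} {S T : Finset R} (hS : dominance u S ≠ 0)
    (hT : dominance u T ≠ 0) (hcard : S.card = T.card) : S = T := by
  rw [dominance_ne_zero_iff] at hS hT
  by_contra hne
  obtain ⟨i, hiS, hiT⟩ := Finset.not_subset.1 fun h => hne (Finset.eq_of_subset_of_card_le h hcard.ge)
  obtain ⟨j, hjT, hjS⟩ :=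
    Finset.not_subset.1 fun h => hne (Finset.eq_of_subset_of_card_le h hcard.le).symm
  exact lt_asymm (hS i hiS j hjS) (hT j hjT i hiT)

theorem dominance_comp (u : R → ℝ) (e : R ≃ R) (S : Finset R) :
    dominance (fun i => u (e i)) S = dominance u (S.map e.toEmbedding) := by
  have h : (S.map e.toEmbedding)ᶜ = Sᶜ.map e.toEmbedding := by
    ext i; simp
  simp only [dominance, h, Finset.prod_map, Equiv.coe_toEmbedding]

theorem continuous_dominance {X : Type*} [TopologicalSpace X] {u : X → R → ℝ}
    (hu : ∀ i, Continuous fun x => u x i) (S : Finset R) :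
    Continuous fun x => dominance (u x) S :=
  continuous_finsetProd _ fun i _ => continuous_finsetProd _ fun j _ =>
    continuous_const.max ((hu i).sub (hu j))

end dominance

/-- The barycenter of a set of residues modulo `r`; meaningful if the size of the set is
invertible modulo `r`. -/
def residueBarycenter {r : ℕ} (S : Finset (ZMod r)) : ZMod r :=
  (S.card : ZMod r)⁻¹ * ∑ i ∈ S, i

theorem residueBarycenter_map_addLeft {r : ℕ} [Fact r.Prime] (a : ZMod r) (S : Finset (ZMod r))
    (h0 : 0 < S.card) (hr : S.card < r) :
    residueBarycenter (S.map (Equiv.addLeft a).toEmbedding) = a + residueBarycenter S := by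
  have hS : (S.card : ZMod r) ≠ 0 := fun h =>
    Nat.not_dvd_of_pos_of_lt h0 hr ((ZMod.natCast_eq_zero_iff _ _).1 h)
  have hsum : ∑ i ∈ S, (a + i) = S.card * a + ∑ i ∈ S, i := by
    rw [Finset.sum_add_distrib, Finset.sum_const, nsmul_eq_mul]
  rw [residueBarycenter, Finset.card_map, Finset.sum_map]
  change (S.card : ZMod r)⁻¹ * ∑ i ∈ S, (a + i) = _
  rw [hsum, mul_add, inv_mul_cancel_left₀ hS, residueBarycenter]

/-- The total dominance weight of the sets of `c` residues with barycenter `g`. -/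
def barycenterWeight {r : ℕ} [NeZero r] (c : ℕ) (u : ZMod r → ℝ) (g : ZMod r) : ℝ :=
  ∑ S : Finset (ZMod r), if S.card = c ∧ residueBarycenter S = g then dominance u S else 0

section barycenterWeight

variable {r : ℕ} [NeZero r]

theorem barycenterWeight_nonneg (c : ℕ) (u : ZMod r → ℝ) (g : ZMod r) :
    0 ≤ barycenterWeight c u g :=
  Finset.sum_nonneg fun S _ => by
    split_ifs
    exacts [dominance_nonneg u S, le_rfl]

theorem barycenterWeight_ne_zero_iff (c : ℕ) (u : ZMod r → ℝ) (g : ZMod r) :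
    barycenterWeight c u g ≠ 0 ↔
      ∃ S : Finset (ZMod r), S.card = c ∧ residueBarycenter S = g ∧ dominance u S ≠ 0 := by
  rw [barycenterWeight, Ne, Finset.sum_eq_zero_iff_of_nonneg]
  · simp
  · intro S _
    split_ifs
    exacts [dominance_nonneg u S, le_rfl]

theorem eq_of_barycenterWeight_ne_zero {c : ℕ} {u : ZMod r → ℝ} {g g' : ZMod r}
    (h : barycenterWeight c u g ≠ 0) (h' : barycenterWeight c u g' ≠ 0) : g = g' := by
  obtain ⟨S, hS, rfl, hd⟩ := (barycenterWeight_ne_zero_iff c u g).1 h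
  obtain ⟨T, hT, rfl, hd'⟩ := (barycenterWeight_ne_zero_iff c u g').1 h'
  rw [eq_of_dominance_ne_zero hd hd' (hS.trans hT.symm)]

theorem continuous_barycenterWeight {X : Type*} [TopologicalSpace X] {u : X → ZMod r → ℝ}
    (hu : ∀ i, Continuous fun x => u x i) (c : ℕ) (g : ZMod r) :
    Continuous fun x => barycenterWeight c (u x) g :=
  continuous_finsetSum _ fun S _ => by
    split_ifs
    exacts [continuous_dominance hu S, continuous_const]

end barycenterWeight

theorem barycenterWeight_comp_addLeft {r : ℕ} [Fact r.Prime] {c : ℕ} (h0 : 0 < c) (hr : c < r)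
    (u : ZMod r → ℝ) (a g : ZMod r) :
    barycenterWeight c (fun i => u (a + i)) g = barycenterWeight c u (a + g) := by
  refine Fintype.sum_equiv (Equiv.addLeft a).finsetCongr _ _ fun S => ?_
  rw [Equiv.finsetCongr_apply, Finset.card_map, ← dominance_comp]
  by_cases hS : S.card = c
  · rw [residueBarycenter_map_addLeft a S (hS ▸ h0) (hS ▸ hr)]
    simp only [add_right_inj, Equiv.coe_addLeft]
  · rw [if_neg (fun h => hS h.1), if_neg (fun h => hS h.1)]

/-! ### Rows that are not faces of `K` -/

section rowExcess

variable {ι R : Type*} [Fintype ι]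

open Classical in
/-- The excess of row `i` of `x` over the complex `K`, a polynomial in the coordinates of `x`. For
`x ≥ 0` it is positive exactly when the support of row `i` is nonempty and not a face of `K`. -/
noncomputable def rowExcess (K : PreAbstractSimplicialComplex ι) (x : JoinVertex ι R → ℝ) (i : R) : ℝ :=
  ∑ τ : Finset ι, if τ.Nonempty ∧ τ ∉ K.faces then ∏ p ∈ τ, x ⟨p, i⟩ else 0

theorem rowExcess_nonneg (K : PreAbstractSimplicialComplex ι) {x : JoinVertex ι R → ℝ}
    (hx : ∀ v, 0 ≤ x v) (i : R) : 0 ≤ rowExcess K x i :=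
  Finset.sum_nonneg fun τ _ => by
    split_ifs
    exacts [Finset.prod_nonneg fun _ _ => hx _, le_rfl]

theorem rowExcess_ne_zero_iff (K : PreAbstractSimplicialComplex ι) {x : JoinVertex ι R → ℝ}
    (hx : ∀ v, 0 ≤ x v) (i : R) :
    rowExcess K x i ≠ 0 ↔ ∃ τ : Finset ι, τ.Nonempty ∧ τ ∉ K.faces ∧ ∀ p ∈ τ, x ⟨p, i⟩ ≠ 0 := by
  rw [rowExcess, Ne, Finset.sum_eq_zero_iff_of_nonneg]
  · simp [Finset.prod_eq_zero_iff]
  · intro τ _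
    split_ifs
    exacts [Finset.prod_nonneg fun _ _ => hx _, le_rfl]

theorem continuous_rowExcess (K : PreAbstractSimplicialComplex ι) (i : R) :
    Continuous fun x : JoinVertex ι R → ℝ => rowExcess K x i :=
  continuous_finsetSum _ fun τ _ => by
    split_ifs
    exacts [continuous_finsetProd _ fun p _ => continuous_apply _, continuous_const]

end rowExcess

theorem card_val_lt {r s : ℕ} [NeZero r] (h : s ≤ r) :
    (Finset.univ.filter fun i : ZMod r => i.val < s).card = s := by
  have himg : (Finset.univ.filter fun i : ZMod r => i.val < s).image ZMod.val
      = Finset.range s := by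
    ext k
    simp only [Finset.mem_image, Finset.mem_filter, Finset.mem_univ, true_and, Finset.mem_range]
    refine ⟨?_, fun hk => ⟨(k : ZMod r), ?_⟩⟩
    · rintro ⟨i, hi, rfl⟩
      exact hi
    · rw [ZMod.val_natCast_of_lt (hk.trans_le h)]
      exact ⟨hk, rfl⟩
  rw [← Finset.card_image_of_injective _ (ZMod.val_injective r), himg, Finset.card_range]

theorem exists_perm_map_into {R : Type*} [Fintype R] [DecidableEq R] {B C : Finset R}
    (h : B.card ≤ C.card) : ∃ π : Equiv.Perm R, ∀ i ∈ B, π i ∈ C := by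
  obtain ⟨D, hDC, hD⟩ := Finset.exists_subset_card_eq h
  let e : {i // i ∈ B} ≃ {i // i ∈ D} := Finset.equivOfCardEq hD.symm
  exact ⟨e.extendSubtype, fun i hi => hDC (e.extendSubtype_mem i hi)⟩

section SDJ

variable {ι : Type*} [Fintype ι] [DecidableEq ι] {r : ℕ} [NeZero r]
  {K L : PreAbstractSimplicialComplex ι}

theorem card_rowExcess_ne_zero_le {t : ℕ} (ht : t ≤ r) {x : JoinVertex ι (ZMod r) → ℝ}
    (hx : x ∈ realization (SDJ r t K L)) :
    (Finset.univ.filter fun i => rowExcess K x i ≠ 0).card ≤ t := by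
  obtain ⟨⟨h0, -⟩, σ, hσ, hxσ⟩ := hx
  obtain ⟨π, -, -, hK⟩ := (mem_symmetrizedDeletedJoin _ _).1 hσ
  rw [← card_val_lt ht]
  refine Finset.card_le_card_of_injOn π (fun i hi => ?_) π.injective.injOn
  simp only [Finset.coe_filter, Finset.mem_univ, true_and, Set.mem_ofPred_eq] at hi ⊢
  obtain ⟨τ, hne, hτ, hτx⟩ := (rowExcess_ne_zero_iff K h0 i).1 hi
  have hsub : τ ⊆ rowPart σ i := fun p hp => by
    simpa [rowPart] using hxσ _ (hτx p hp)
  by_contra hlt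
  rcases hK i with h | h
  · exact hne.ne_empty (Finset.subset_empty.1 (h ▸ hsub))
  · simp only [klCollection, if_neg hlt] at h
    exact hτ ((K.isRelLowerSet_faces h).2 hsub hne)

theorem mem_realization_SDJ_of_card_le (hKL : K ≤ L) {s t : ℕ} (hs : s ≤ r)
    {x : JoinVertex ι (ZMod r) → ℝ} (hx : x ∈ realization (SDJ r t K L))
    (hcard : (Finset.univ.filter fun i => rowExcess K x i ≠ 0).card ≤ s) :
    x ∈ realization (SDJ r s K L) := by
  obtain ⟨⟨h0, h1⟩, σ, hσ, hxσ⟩ := hx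
  obtain ⟨ρ, -, hdisj, hK⟩ := (mem_symmetrizedDeletedJoin _ _).1 hσ
  obtain ⟨π, hπ⟩ := exists_perm_map_into (hcard.trans (card_val_lt hs).ge)
  -- The excess only sees the support of `x`, which can be smaller than the face `σ`.
  have hsub : ∀ i, rowPart (Finset.univ.filter fun v => x v ≠ 0) i ⊆ rowPart σ i := fun i p hp => by
    simp only [rowPart, Finset.mem_filter, Finset.mem_univ, true_and] at hp ⊢
    exact hxσ _ hp
  refine ⟨⟨h0, h1⟩, Finset.univ.filter fun v => x v ≠ 0, (mem_symmetrizedDeletedJoin _ _).2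
    ⟨π, ?_, fun i j hij => (hdisj i j hij).mono (hsub i) (hsub j), fun i => ?_⟩, fun v hv => by
      simpa using hv⟩
  · obtain ⟨v, -, hv⟩ := Finset.exists_ne_zero_of_sum_ne_zero (h1.trans_ne one_ne_zero)
    exact ⟨v, by simpa using hv⟩
  · rcases Finset.eq_empty_or_nonempty (rowPart (Finset.univ.filter fun v => x v ≠ 0) i)
      with hemp | hne
    · exact Or.inl hemp
    refine Or.inr ?_
    have hL : rowPart (Finset.univ.filter fun v => x v ≠ 0) i ∈ L.faces := by
      rcases hK i with h | h
      · exact absurd (Finset.subset_empty.1 (h ▸ hsub i)) hne.ne_empty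
      · have h' : rowPart σ i ∈ L.faces := by
          simp only [klCollection] at h
          split_ifs at h
          exacts [h, hKL h]
        exact (L.isRelLowerSet_faces h').2 (hsub i) hne
    by_cases hi : rowExcess K x i ≠ 0
    · have hlt : (π i).val < s := by simpa using hπ i (by simpa using hi)
      simpa only [klCollection, if_pos hlt] using hL
    · have hmem : rowPart (Finset.univ.filter fun v => x v ≠ 0) i ∈ K.faces := by
        by_contra hn
        exact hi ((rowExcess_ne_zero_iff K h0 i).2 ⟨_, hne, hn, fun p hp => by
          simpa [rowPart] using hp⟩)
      simp only [klCollection]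
      split_ifs
      exacts [hL, hmem]

end SDJ

/-! ### Extending equivariant maps -/

theorem isClosed_realization {V : Type*} [Fintype V] (K : PreAbstractSimplicialComplex V) :
    IsClosed (realization K) := by
  have h : realization K = stdSimplex ℝ V ∩ ⋃ σ ∈ K.faces, ⋂ v ∈ {v | v ∉ σ}, {x | x v = 0} := by
    ext x
    simp only [realization, Set.mem_ofPred_eq, Set.mem_inter_iff, Set.mem_iUnion, Set.mem_iInter,
      exists_prop]
    refine and_congr_right fun _ => exists_congr fun σ => and_congr_right fun _ =>
      forall_congr' fun v => not_imp_comm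
  rw [h]
  refine (isClosed_stdSimplex ℝ V).inter ((Set.toFinite _).isClosed_biUnion fun σ _ =>
    isClosed_biInter fun v _ => isClosed_eq (continuous_apply v) continuous_const)

/-- An equivariant map to a join of copies of `G` extends, as a system of real coordinates, to the
ambient space. It is enough to extend its coordinates at `1 ∈ G`: the others are the translates of
these, and so the extension is equivariant by construction. -/
theorem exists_equivariant_extension {G : Type*} [Group G] [Fintype G] {V : Type*} [Fintype V]
    [MulAction G V] (K : PreAbstractSimplicialComplex V) [InvariantComplex G K] {n : ℕ}
    (f : realization K → realization (iteratedJoin G n)) (hf : Continuous f)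
    (heq : ∀ (g : G) x, f (g • x) = g • f x) :
    ∃ F : (V → ℝ) → Fin (n + 1) → G → ℝ, (∀ k g, Continuous fun x => F x k g) ∧
      (∀ (a : G) x k g, F (fun v => x (a⁻¹ • v)) k g = F x k (a⁻¹ * g)) ∧
      ∀ x : realization K, ∀ k g, F x k g = (f x).1 ⟨k, g⟩ := by
  have hext : ∀ k : Fin (n + 1), ∃ Φ : C(V → ℝ, ℝ), ∀ x : realization K,
      Φ x.1 = (f x).1 ⟨k, 1⟩ := fun k => by
    obtain ⟨Φ, hΦ⟩ := ContinuousMap.exists_restrict_eq (isClosed_realization K)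
      (⟨fun x => (f x).1 ⟨k, 1⟩, (continuous_apply _).comp (continuous_subtype_val.comp hf)⟩ :
        C(realization K, ℝ))
    exact ⟨Φ, fun x => congrArg (fun Ψ => Ψ x) hΦ⟩
  choose Φ hΦ using hext
  refine ⟨fun x k g => Φ k fun v => x (g • v), fun k g => (Φ k).continuous.comp
    (continuous_pi fun v => continuous_apply _), fun a x k g => ?_, fun x k g => ?_⟩
  · simp only [mul_smul]
  · have h : (fun v => x.1 (g • v)) = (g⁻¹ • x).1 := funext fun v =>
      congrArg x.1 (by rw [inv_inv])
    change Φ k (fun v => x.1 (g • v)) = _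
    rw [h, hΦ, heq]
    change (f x).1 (g⁻¹⁻¹ • (⟨k, 1⟩ : JoinVertex (Fin (n + 1)) G)) = _
    rw [inv_inv, Sigma.smul_mk, smul_eq_mul, mul_one]

/-! ### Comparison of the indices -/

/-- An equivariant map from the `s`-th symmetrized deleted join to `E_n G` yields one from the
`t`-th to `E_{n + t - s} G`. -/
theorem gIndex_SDJ_le {ι : Type*} [Fintype ι] [DecidableEq ι] {r : ℕ} [Fact r.Prime] {s t : ℕ}
    (hst : s ≤ t) (ht : t < r) {K L : PreAbstractSimplicialComplex ι} (hKL : K ≤ L) {n : ℕ}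
    (f : realization (SDJ r s K L) → realization (iteratedJoin (Multiplicative (ZMod r)) n))
    (hf : Continuous f) (heq : ∀ (g : Multiplicative (ZMod r)) x, f (g • x) = g • f x) :
    gIndex (Multiplicative (ZMod r)) (realization (SDJ r t K L)) ≤ (n + (t - s) : ℕ) := by
  obtain ⟨F, hFc, hFeq, hFf⟩ := exists_equivariant_extension (SDJ r s K L) f hf heq
  let z : realization (SDJ r t K L) → Fin (n + 1) ⊕ Fin (t - s) → Multiplicative (ZMod r) → ℝ :=
    fun x => Sum.elim (fun k g => dominance (F x.1 k) {g})
      fun j g => barycenterWeight (s + 1 + j) (rowExcess K x.1) g.toAdd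
  refine gIndex_le_of_weights (ι := Fin (n + 1) ⊕ Fin (t - s)) ?_ z ?_ ?_ ?_ ?_ ?_
  · simp only [Fintype.card_sum, Fintype.card_fin]
    omega
  · rintro (k | j) g
    · exact continuous_dominance (fun i => (hFc k i).comp continuous_subtype_val) _
    · exact continuous_barycenterWeight
        (fun i => (continuous_rowExcess K i).comp continuous_subtype_val) _ _
  · rintro x (k | j) g
    · exact dominance_nonneg _ _
    · exact barycenterWeight_nonneg _ _ _
  · rintro a x (k | j) g
    · change dominance (F (fun v => x.1 (a⁻¹ • v)) k) {g} = dominance (F x.1 k) {a⁻¹ * g}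
      rw [funext fun g => hFeq a x.1 k g]
      exact (dominance_comp (F x.1 k) (Equiv.mulLeft a⁻¹) {g}).trans (by simp)
    · exact barycenterWeight_comp_addLeft (by omega) (by omega) (rowExcess K x.1)
        (-a.toAdd) g.toAdd
  · rintro x (k | j) g g' h h'
    · exact Finset.singleton_injective (eq_of_dominance_ne_zero h h' rfl)
    · exact eq_of_barycenterWeight_ne_zero h h'
  · intro x
    let S : Finset (ZMod r) := Finset.univ.filter fun i => rowExcess K x.1 i ≠ 0
    by_cases hS : S.card ≤ s
    · let y : realization (SDJ r s K L) :=
        ⟨x.1, mem_realization_SDJ_of_card_le hKL (hst.trans ht.le) x.2 hS⟩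
      obtain ⟨⟨h0, h1⟩, σ, hσ, hfσ⟩ := (f y).2
      obtain ⟨⟨k, g⟩, -, hg⟩ := Finset.exists_ne_zero_of_sum_ne_zero (h1.trans_ne one_ne_zero)
      refine ⟨Sum.inl k, g, (dominance_ne_zero_iff _ _).2 fun i hi j hj => ?_⟩
      obtain rfl := Finset.mem_singleton.1 hi
      rw [hFf y, hFf y]
      have hj0 : (f y).1 ⟨k, j⟩ = 0 := by
        by_contra hne
        refine hj (Finset.mem_singleton.2 ?_)
        simpa using hσ.2 _ (hfσ _ hne) _ (hfσ _ hg) rfl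
      rw [hj0]
      exact lt_of_le_of_ne (h0 _) hg.symm
    · have hSt : S.card ≤ t := card_rowExcess_ne_zero_le ht.le x.2
      refine ⟨Sum.inr ⟨S.card - (s + 1), by omega⟩, Multiplicative.ofAdd (residueBarycenter S),
        (barycenterWeight_ne_zero_iff _ _ _).2 ⟨S, ?_, rfl, ?_⟩⟩
      · change S.card = s + 1 + (S.card - (s + 1))
        omega
      · refine (dominance_ne_zero_iff _ _).2 fun i hi j hj => ?_
        have hi' : rowExcess K x.1 i ≠ 0 := by simpa [S] using hi
        have hj' : rowExcess K x.1 j = 0 := by simpa [S] using hj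
        rw [hj']
        exact lt_of_le_of_ne (rowExcess_nonneg K x.2.1.1 i) hi'.symm

theorem proposition6p2 (r : ℕ) [Fact r.Prime] (hr : 3 ≤ r) (s t : ℕ) (hs : 1 ≤ s) (hst : s < t)
    (ht : t < r) (m : ℕ) (K L : PreAbstractSimplicialComplex (Fin m)) (hKL : K ≤ L) :
    (gIndex (Multiplicative (ZMod r)) (realization (SDJ r s K L)) : EReal) ≥
      (gIndex (Multiplicative (ZMod r)) (realization (SDJ r t K L)) : EReal) +
        (s : EReal) - (t : EReal) := by
  have key : gIndex (Multiplicative (ZMod r)) (realization (SDJ r t K L)) ≤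
      gIndex (Multiplicative (ZMod r)) (realization (SDJ r s K L)) + (t - s : ℕ) := by
    conv_rhs => rw [gIndex]
    rw [ENat.iInf_add]
    refine le_iInf fun n => ?_
    rw [ENat.iInf_add]
    refine le_iInf fun ⟨f, hf, heq⟩ => ?_
    exact_mod_cast gIndex_SDJ_le hst.le ht hKL f hf heq
  generalize gIndex (Multiplicative (ZMod r)) (realization (SDJ r s K L)) = a at key ⊢
  generalize gIndex (Multiplicative (ZMod r)) (realization (SDJ r t K L)) = b at key ⊢
  induction a using ENat.recTopCoe with
  | top => exact le_top
  | coe a =>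
    lift b to ℕ using ne_top_of_le_ne_top (by exact_mod_cast ENat.natCast_ne_top (a + (t - s))) key
    have h : b ≤ a + (t - s) := by exact_mod_cast key
    have h' : (b : ℝ) + s - t ≤ a := by
      have : b + s ≤ a + t := by omega
      have : (b : ℝ) + s ≤ a + t := by exact_mod_cast this
      linarith
    exact EReal.coe_le_coe_iff.2 h'
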